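/- **Definitions.** Let $H$ be a finite group. A *spherical system of generators* of $H$ of size $r$ is a tuple $T=(g_1,\dots,g_r)$ of non-trivial elements of $H$ with $\langle g_1,\dots,g_r\rangle=H$ and $g_1g_2\cdots g_r=1$. Put $\Sigma(T)=\bigcup_{g\in H}\bigcup_{i=1}^r\langle g_i\rangle^g$. A *ramification structure* of size $(r_1,r_2)$ for $H$ is a pair $(T_1,T_2)$ of spherical systems of generators of $H$, of sizes $r_1$ and $r_2$, with $\Sigma(T_1)\cap\Sigma(T_2)=\{1\}$. Let $S(H)$ be the set of sizes of all ramification structures of $H$, and let $d(H)$ be the minimum number of generators of $H$. A finite $p$-group $H$ of exponent $p^e$, $e\ge 1$, is *semi-$p^{e-1}$-abelian* if for all $x,y\in H$ one has $x^{p^{e-1}}=y^{p^{e-1}}$ if and only if $(xy^{-1})^{p^{e-1}}=1$. **Theorem B.** Let $G$ be a non-trivial finite nilpotent group and let $d=d(G)$. For every prime $p$ dividing $|G|$, let $G_p$ be the Sylow $p$-subgroup of $G$ and let $\exp G_p=p^{e_p}$. Suppose that $G_p$ is semi-$p^{e_p-1}$-abelian for every prime $p$ dividing $|G|$. Then $G$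 admits a ramification structure if and only if $G_p$ admits a ramification structure for every prime $p$ dividing $|G|$. Moreover, for all non-negative integers $r_1,r_2$, we have $(r_1,r_2)\in S(G)$ if and only if all of the following conditions hold: 1. $r_1,r_2\ge d+1$. 2. $(r_1,r_2)\in S(G_p)$ for every odd prime $p$ dividing $|G|$. 3. If $2$ divides $|G|$ and $G_2\not\cong C_2\times C_2\times C_2$, then $(r_1,r_2)\in S(G_2)$. 4. If $G_2\cong C_2\times C_2\times C_2$, then $r_1,r_2\ge 5$ and $(r_1,r_2)\ne(5,5)$; furthermore, if $G\cong C_2\times C_2\times C_2$, then $r_1$ and $r_2$ are not both odd. -/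

import Mathlib

/-- A tuple `T` of non-trivial elements of `G` is a spherical system of generators
if it generates `G` and the product of its entries, in order, is `1`. -/
structure IsSphericalSystem {G : Type*} [Group G] (T : List G) : Prop where
  ne_one : ∀ t ∈ T, t ≠ 1
  closure_eq_top : Subgroup.closure {t : G | t ∈ T} = ⊤
  prod_eq_one : T.prod = 1

/-- `Σ(T)`: the union of all conjugates `⟨t⟩ ^ g = g⁻¹ ⟨t⟩ g` of the cyclic subgroups
generated by the entries `t` of `T`. -/
def sigmaSet {G : Type*} [Group G] (T : List G) : Set G :=
  {x : G | ∃ g : G, ∃ t ∈ T, ∃ y ∈ Subgroup.zpowers t, x = g⁻¹ * y * g}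

/-- An (unmixed) ramification structure of `G`: a pair of disjoint spherical systems of
generators. Its size is the pair of the lengths of the two tuples. -/
structure IsRamificationStructure {G : Type*} [Group G] (T₁ T₂ : List G) : Prop where
  left : IsSphericalSystem T₁
  right : IsSphericalSystem T₂
  disjoint : sigmaSet T₁ ∩ sigmaSet T₂ = {1}

/-- `S(G)`: the set of all sizes `(r₁, r₂)` of ramification structures of `G`. -/
def ramificationSizes (G : Type*) [Group G] : Set (ℕ × ℕ) :=
  {r : ℕ × ℕ | ∃ T₁ T₂ : List G, IsRamificationStructure T₁ T₂ ∧
    T₁.length = r.1 ∧ T₂.length = r.2}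

/-- `G` admits a ramification structure (of some size). -/
def HasRamificationStructure (G : Type*) [Group G] : Prop :=
  ∃ T₁ T₂ : List G, IsRamificationStructure T₁ T₂

/-- `G` is semi-`n`-abelian; used for a `p`-group of exponent `p ^ e` with `n = p ^ (e - 1)`. -/
def IsSemiAbelian (n : ℕ) (G : Type*) [Group G] : Prop :=
  ∀ x y : G, x ^ n = y ^ n ↔ (x * y⁻¹) ^ n = 1

/-- The elementary abelian group `C₂ × C₂ × C₂`, written multiplicatively. -/
abbrev C2Cubed : Type :=
  Multiplicative (ZMod 2) × Multiplicative (ZMod 2) × Multiplicative (ZMod 2)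

/-! Relax the definition by allowing trivial entries. For a product of groups of pairwise coprime
orders, such lax structures are exactly the tuples whose coordinates are lax structures of the
factors (`IsLaxStructure.map_eval`, `isLaxStructure_of_map_eval`), because each coordinate of an
element is one of its powers. A nilpotent group is the product of its Sylow subgroups, so it remains
to compare lax and proper sizes of each Sylow subgroup. To lift back to `G` it is enough that one
factor has no trivial entries (`ramificationSizes_pi`).

If every generating tuple contains some `t` with `t ^ 2 ≠ 1`, trivial entries can be absorbed by
splitting `t` (`exists_spherical_of_sq_ne_one`), so lax and proper sizes agree. This covers odd `p`,
and also 2-groups of exponent at least 4, where the semi-abelian condition makes the elements killed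
by `2 ^ (e - 1)` a proper subgroup.

There remain the elementary abelian 2-groups. In rank at most 2 there are no lax structures; in rank
at least 4 all sizes above the rank occur. Rank 3 is the only exception: one of the two tuples must
have a basis as its set of non-trivial entries, so each of these occurs an even number of times.
This gives the bound 6 on that side, and parity once trivial entries are forbidden. -/

/-! ### Lax and proper structures, and operations on tuples. -/

section Basic

variable {G H : Type*} [Group G] [Group H]

/-- A generating tuple with product `1`, whose entries may be trivial. -/
structure IsLaxSystem (T : List G) : Prop where
  closure_eq_top : Subgroup.closure {t : G | t ∈ T} = ⊤
  prod_eq_one : T.prod = 1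

/-- A ramification structure whose tuples may contain trivial entries. -/
structure IsLaxStructure (T₁ T₂ : List G) : Prop where
  left : IsLaxSystem T₁
  right : IsLaxSystem T₂
  disjoint : ∀ x ∈ sigmaSet T₁, x ∈ sigmaSet T₂ → x = 1

theorem mem_sigmaSet_of_mem {T : List G} {t : G} (ht : t ∈ T) : t ∈ sigmaSet T :=
  ⟨1, t, ht, t, Subgroup.mem_zpowers t, by simp⟩

theorem zpow_mem_sigmaSet {T : List G} {x : G} (hx : x ∈ sigmaSet T) (n : ℤ) :
    x ^ n ∈ sigmaSet T := by
  obtain ⟨g, t, ht, y, hy, rfl⟩ := hx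
  refine ⟨g, t, ht, y ^ n, Subgroup.zpow_mem _ hy n, ?_⟩
  have := conj_zpow (i := n) (a := g⁻¹) (b := y)
  simpa using this

theorem sigmaSet_subset_of_mem_zpowers {T T' : List G}
    (h : ∀ t' ∈ T', ∃ t ∈ T, t' ∈ Subgroup.zpowers t) : sigmaSet T' ⊆ sigmaSet T := by
  rintro x ⟨g, t', ht', y, hy, rfl⟩
  obtain ⟨t, ht, htt⟩ := h t' ht'
  exact ⟨g, t, ht, y, (Subgroup.zpowers_le.2 htt) hy, rfl⟩

theorem map_mem_sigmaSet (f : G →* H) {T : List G} {x : G} (hx : x ∈ sigmaSet T) :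
    f x ∈ sigmaSet (T.map f) := by
  obtain ⟨g, t, ht, y, ⟨n, rfl⟩, rfl⟩ := hx
  exact ⟨f g, f t, List.mem_map_of_mem ht, f t ^ n, ⟨n, rfl⟩, by simp⟩

theorem IsLaxSystem.ne_nil [Nontrivial G] {T : List G} (hT : IsLaxSystem T) : T ≠ [] := by
  rintro rfl
  have := hT.closure_eq_top
  simp at this

theorem IsLaxSystem.map {T : List G} (hT : IsLaxSystem T) (f : G →* H)
    (hf : Function.Surjective f) : IsLaxSystem (T.map f) := by
  constructor
  · have := congrArg (Subgroup.map f) hT.closure_eq_top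
    rw [Subgroup.map_top_of_surjective f hf, MonoidHom.map_closure] at this
    rw [← this]
    congr 1
    ext x
    simp
  · rw [List.prod_hom, hT.prod_eq_one, map_one]

theorem IsLaxStructure.symm {T₁ T₂ : List G} (h : IsLaxStructure T₁ T₂) :
    IsLaxStructure T₂ T₁ :=
  ⟨h.right, h.left, fun x h₁ h₂ => h.disjoint x h₂ h₁⟩

theorem IsLaxStructure.ne_of_mem {T₁ T₂ : List G} (h : IsLaxStructure T₁ T₂) {t : G}
    (h₁ : t ∈ T₁) (h₂ : t ∈ T₂) : t = 1 :=
  h.disjoint t (mem_sigmaSet_of_mem h₁) (mem_sigmaSet_of_mem h₂)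

theorem IsLaxStructure.map_mulEquiv {T₁ T₂ : List G} (h : IsLaxStructure T₁ T₂) (φ : G ≃* H) :
    IsLaxStructure (T₁.map φ) (T₂.map φ) := by
  refine ⟨h.left.map φ.toMonoidHom φ.surjective, h.right.map φ.toMonoidHom φ.surjective, ?_⟩
  intro x h₁ h₂
  have h₁' := map_mem_sigmaSet φ.symm.toMonoidHom h₁
  have h₂' := map_mem_sigmaSet φ.symm.toMonoidHom h₂
  simp only [List.map_map] at h₁' h₂'
  have e : ∀ T : List G, List.map (⇑φ.symm.toMonoidHom ∘ ⇑φ) T = T := fun T => by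
    conv_rhs => rw [← List.map_id T]
    congr 1
    ext; simp
  rw [e] at h₁' h₂'
  have := h.disjoint _ h₁' h₂'
  simpa using this

theorem isRamificationStructure_iff [Nontrivial G] {T₁ T₂ : List G} :
    IsRamificationStructure T₁ T₂ ↔
      IsLaxStructure T₁ T₂ ∧ (∀ t ∈ T₁, t ≠ 1) ∧ ∀ t ∈ T₂, t ≠ 1 := by
  constructor
  · rintro ⟨h₁, h₂, h⟩
    refine ⟨⟨⟨h₁.2, h₁.3⟩, ⟨h₂.2, h₂.3⟩, fun x hx hx' => ?_⟩, h₁.1, h₂.1⟩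
    have : x ∈ sigmaSet T₁ ∩ sigmaSet T₂ := ⟨hx, hx'⟩
    rwa [h] at this
  · rintro ⟨⟨h₁, h₂, h⟩, n₁, n₂⟩
    refine ⟨⟨n₁, h₁.1, h₁.2⟩, ⟨n₂, h₂.1, h₂.2⟩, ?_⟩
    have one_mem : ∀ T : List G, IsLaxSystem T → (1 : G) ∈ sigmaSet T := fun T hT => by
      obtain ⟨t, ht⟩ := List.exists_mem_of_ne_nil T hT.ne_nil
      simpa using zpow_mem_sigmaSet (mem_sigmaSet_of_mem ht) 0
    ext x
    constructor
    · rintro ⟨hx, hx'⟩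
      exact h x hx hx'
    · rintro rfl
      exact ⟨one_mem _ h₁, one_mem _ h₂⟩

/-- The set of sizes of structures whose tuples may contain trivial entries. -/
def laxSizes (G : Type*) [Group G] : Set (ℕ × ℕ) :=
  {r | ∃ T₁ T₂ : List G, IsLaxStructure T₁ T₂ ∧ T₁.length = r.1 ∧ T₂.length = r.2}

theorem laxSizes_swap {r₁ r₂ : ℕ} (h : (r₁, r₂) ∈ laxSizes G) : (r₂, r₁) ∈ laxSizes G := by
  obtain ⟨T₁, T₂, hT, h₁, h₂⟩ := h
  exact ⟨T₂, T₁, hT.symm, h₂, h₁⟩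

theorem laxSizes_of_mulEquiv (φ : G ≃* H) {r : ℕ × ℕ} (h : r ∈ laxSizes G) : r ∈ laxSizes H := by
  obtain ⟨T₁, T₂, hT, h₁, h₂⟩ := h
  exact ⟨T₁.map φ, T₂.map φ, hT.map_mulEquiv φ, by simpa, by simpa⟩

theorem mem_ramificationSizes_iff [Nontrivial G] {r₁ r₂ : ℕ} :
    (r₁, r₂) ∈ ramificationSizes G ↔ ∃ T₁ T₂ : List G, IsLaxStructure T₁ T₂ ∧
      (∀ t ∈ T₁, t ≠ 1) ∧ (∀ t ∈ T₂, t ≠ 1) ∧ T₁.length = r₁ ∧ T₂.length = r₂ := by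
  simp only [ramificationSizes, Set.mem_ofPred_eq, isRamificationStructure_iff, and_assoc]

theorem mem_laxSizes_of_mem_ramificationSizes [Nontrivial G] {r : ℕ × ℕ}
    (h : r ∈ ramificationSizes G) : r ∈ laxSizes G := by
  obtain ⟨T₁, T₂, h, -, -, h₁, h₂⟩ := mem_ramificationSizes_iff.1 h
  exact ⟨T₁, T₂, h, h₁, h₂⟩

theorem ramificationSizes_of_mulEquiv [Nontrivial G] (φ : G ≃* H) {r : ℕ × ℕ}
    (h : r ∈ ramificationSizes G) : r ∈ ramificationSizes H := by
  have : Nontrivial H := φ.symm.surjective.nontrivial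
  obtain ⟨T₁, T₂, h, n₁, n₂, h₁, h₂⟩ := mem_ramificationSizes_iff.1 h
  exact mem_ramificationSizes_iff.2 ⟨T₁.map φ, T₂.map φ, h.map_mulEquiv φ, by simpa using n₁,
    by simpa using n₂, by simpa, by simpa⟩

theorem ramificationSizes_swap [Nontrivial G] {r₁ r₂ : ℕ} (h : (r₁, r₂) ∈ ramificationSizes G) :
    (r₂, r₁) ∈ ramificationSizes G := by
  obtain ⟨T₁, T₂, h, n₁, n₂, h₁, h₂⟩ := mem_ramificationSizes_iff.1 h
  exact mem_ramificationSizes_iff.2 ⟨T₂, T₁, h.symm, n₂, n₁, h₂, h₁⟩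

/-- Replacing a tuple by a system with entries in the cyclic subgroups of its entries. -/
theorem IsLaxStructure.replace_left {T₁ T₂ T : List G} (h : IsLaxStructure T₁ T₂)
    (hT : IsLaxSystem T) (hsub : ∀ t' ∈ T, ∃ t ∈ T₁, t' ∈ Subgroup.zpowers t) :
    IsLaxStructure T T₂ :=
  ⟨hT, h.right, fun x h₁ h₂ => h.disjoint x (sigmaSet_subset_of_mem_zpowers hsub h₁) h₂⟩

theorem IsLaxSystem.flatten_replicate {T : List G} (h : IsLaxSystem T) {m : ℕ} (hm : m ≠ 0) :
    IsLaxSystem (List.replicate m T).flatten := by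
  refine ⟨?_, ?_⟩
  · rw [← h.closure_eq_top]
    congr 1
    ext x
    simp [hm]
  · simp [List.prod_flatten, h.prod_eq_one]

/-- Repeating a tuple preserves its product, the subgroup it generates and its `Σ`. This brings all
Sylow subgroups to a common size. -/
theorem ramificationSizes_mul [Nontrivial G] {r₁ r₂ m₁ m₂ : ℕ} (hm₁ : m₁ ≠ 0) (hm₂ : m₂ ≠ 0)
    (h : (r₁, r₂) ∈ ramificationSizes G) : (m₁ * r₁, m₂ * r₂) ∈ ramificationSizes G := by
  have key : ∀ {r₁ r₂ m : ℕ}, m ≠ 0 → (r₁, r₂) ∈ ramificationSizes G →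
      (m * r₁, r₂) ∈ ramificationSizes G := by
    intro r₁ r₂ m hm h
    obtain ⟨T₁, T₂, h, n₁, n₂, h₁, h₂⟩ := mem_ramificationSizes_iff.1 h
    refine mem_ramificationSizes_iff.2 ⟨(List.replicate m T₁).flatten, T₂,
      h.replace_left (h.left.flatten_replicate hm) fun t ht => ⟨t, ?_, Subgroup.mem_zpowers t⟩,
      fun t ht => n₁ t ?_, n₂, by simp [h₁], h₂⟩ <;> simp_all
  exact ramificationSizes_swap (key hm₂ (ramificationSizes_swap (key hm₁ h)))

/-- An entry and its inverse can be prepended without affecting the product or enlarging `Σ`. -/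
theorem ramificationSizes_add_even [Nontrivial G] {r₁ r₂ : ℕ} (k₁ k₂ : ℕ)
    (h : (r₁, r₂) ∈ ramificationSizes G) :
    (r₁ + 2 * k₁, r₂ + 2 * k₂) ∈ ramificationSizes G := by
  have key : ∀ {r₁ r₂ : ℕ} (k : ℕ), (r₁, r₂) ∈ ramificationSizes G →
      (r₁ + 2 * k, r₂) ∈ ramificationSizes G := by
    intro r₁ r₂ k h
    induction k with
    | zero => exact h
    | succ k ih =>
      obtain ⟨T₁, T₂, h, n₁, n₂, h₁, h₂⟩ := mem_ramificationSizes_iff.1 ih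
      obtain ⟨t, ht⟩ := List.exists_mem_of_ne_nil T₁ h.left.ne_nil
      refine mem_ramificationSizes_iff.2 ⟨t :: t⁻¹ :: T₁, T₂, h.replace_left ⟨?_, ?_⟩ ?_, ?_, n₂,
        by simp [h₁]; ring, h₂⟩
      · refine top_le_iff.1 (h.left.closure_eq_top.symm.le.trans (Subgroup.closure_mono ?_))
        intro x hx
        simp_all
      · simp [h.left.prod_eq_one]
      · intro x hx
        simp only [List.mem_cons] at hx
        rcases hx with rfl | rfl | hx
        · exact ⟨x, ht, Subgroup.mem_zpowers x⟩
        · exact ⟨t, ht, Subgroup.inv_mem _ (Subgroup.mem_zpowers t)⟩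
        · exact ⟨x, hx, Subgroup.mem_zpowers x⟩
      · simpa using ⟨n₁ t ht, n₁⟩
  exact ramificationSizes_swap (key k₂ (ramificationSizes_swap (key k₁ h)))

/-- The product relation expresses the first entry through the others, so the tail already
generates. -/
theorem rank_lt_length [Finite G] [Nontrivial G] {T : List G} (hT : IsLaxSystem T) :
    Group.rank G + 1 ≤ T.length := by
  classical
  obtain ⟨t, l, rfl⟩ := List.exists_cons_of_ne_nil hT.ne_nil
  have hl : Subgroup.closure ((l.toFinset : Finset G) : Set G) = ⊤ := by
    rw [← top_le_iff, ← hT.closure_eq_top, Subgroup.closure_le]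
    have hmem : ∀ x ∈ l, x ∈ Subgroup.closure ((l.toFinset : Finset G) : Set G) := fun x hx =>
      Subgroup.subset_closure (by simpa using hx)
    intro x hx
    rcases List.mem_cons.1 hx with rfl | hx
    · have := hT.prod_eq_one
      rw [List.prod_cons, mul_eq_one_iff_eq_inv] at this
      rw [this]
      exact Subgroup.inv_mem _ (Subgroup.list_prod_mem _ hmem)
    · exact hmem x hx
  have := Group.rank_le hl
  have := l.toFinset_card_le
  simp only [List.length_cons]
  omega

end Basic

/-! ### Replacing trivial entries by splitting an entry of order greater than 2. -/

section Split

variable {G : Type*} [Group G]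

/-- A tuple of length `m + 1` in `⟨t⟩` with product `t`, generating `⟨t⟩`;
its entries are non-trivial when `t ^ 2 ≠ 1`. -/
def splitList (t : G) : ℕ → List G
  | 0 => [t]
  | 1 => [t ^ 2, t⁻¹]
  | m + 2 => t :: t⁻¹ :: splitList t m

theorem length_splitList (t : G) : ∀ m, (splitList t m).length = m + 1
  | 0 => rfl
  | 1 => rfl
  | m + 2 => by simp [splitList, length_splitList t m]

theorem prod_splitList (t : G) : ∀ m, (splitList t m).prod = t
  | 0 => by simp [splitList]
  | 1 => by simp [splitList, pow_two]
  | m + 2 => by simp [splitList, prod_splitList t m]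

theorem mem_zpowers_of_mem_splitList (t : G) :
    ∀ m, ∀ x ∈ splitList t m, x ∈ Subgroup.zpowers t
  | 0 => by simp [splitList]
  | 1 => by simp [splitList]
  | m + 2 => by simpa [splitList] using mem_zpowers_of_mem_splitList t m

theorem ne_one_of_mem_splitList {t : G} (ht : t ^ 2 ≠ 1) : ∀ m, ∀ x ∈ splitList t m, x ≠ 1 := by
  have h1 : t ≠ 1 := by rintro rfl; simp at ht
  intro m
  induction m using splitList.induct with
  | case1 => simp [splitList, h1]
  | case2 => simpa [splitList] using ⟨ht, h1⟩
  | case3 m ih => simpa [splitList] using ⟨h1, ih⟩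

theorem mem_closure_splitList (t : G) (m : ℕ) :
    t ∈ Subgroup.closure {x | x ∈ splitList t m} := by
  have h : (splitList t m).prod ∈ Subgroup.closure {x | x ∈ splitList t m} :=
    Subgroup.list_prod_mem _ fun x hx => Subgroup.subset_closure hx
  rwa [prod_splitList] at h

theorem exists_spherical_of_sq_ne_one {T : List G} (hT : IsLaxSystem T) {t : G} (ht : t ∈ T)
    (ht2 : t ^ 2 ≠ 1) : ∃ T' : List G, IsLaxSystem T' ∧ (∀ x ∈ T', x ≠ 1) ∧
      T'.length = T.length ∧ ∀ t' ∈ T', ∃ t ∈ T, t' ∈ Subgroup.zpowers t := by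
  classical
  have h1 : t ≠ 1 := by rintro rfl; simp at ht2
  have hprod : ∀ l : List G, (l.filter (fun x : G => x ≠ 1)).prod = l.prod := by
    intro l
    induction l with
    | nil => simp
    | cons a l ih =>
      by_cases ha : a = 1
      · simp [ha, ← ih]
      · simp [ha, ← ih]
  have htN : t ∈ T.filter (fun x : G => x ≠ 1) := by simp [ht, h1]
  obtain ⟨l₁, l₂, hN⟩ := List.append_of_mem htN
  have hlen := List.length_filter_le (fun x : G => decide (x ≠ 1)) T
  have hmemN : ∀ x, x ∈ T ∧ x ≠ 1 ↔ x ∈ l₁ ++ t :: l₂ := fun x => by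
    rw [← hN]; simp
  -- The number of trivial entries removed: `splitList t m` has `m + 1` entries, so putting it in
  -- place of `t` restores the length.
  set m := T.length - (T.filter (fun x : G => x ≠ 1)).length with hm
  refine ⟨l₁ ++ (splitList t m ++ l₂), ⟨?_, ?_⟩, ?_, ?_, ?_⟩
  · rw [← top_le_iff, ← hT.closure_eq_top, Subgroup.closure_le]
    intro x hx
    by_cases hx1 : x = 1
    · rw [hx1]; exact Subgroup.one_mem _
    have := (hmemN x).1 ⟨hx, hx1⟩
    simp only [List.mem_append, List.mem_cons] at this
    rcases this with h | rfl | h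
    · exact Subgroup.subset_closure (by simp [h])
    · exact Subgroup.closure_mono
        (show {y | y ∈ splitList x m} ⊆ {y | y ∈ l₁ ++ (splitList x m ++ l₂)} from
          fun y (hy : y ∈ splitList x m) => by simp [hy]) (mem_closure_splitList x m)
    · exact Subgroup.subset_closure (by simp [h])
  · rw [← hT.prod_eq_one, ← hprod T, hN]
    simp [prod_splitList]
  · intro x hx
    simp only [List.mem_append] at hx
    rcases hx with h | h | h
    · exact ((hmemN x).2 (by simp [h])).2
    · exact ne_one_of_mem_splitList ht2 m x h
    · exact ((hmemN x).2 (by simp [h])).2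
  · rw [hN] at hm hlen
    simp only [List.length_append, length_splitList, List.length_cons] at hm hlen ⊢
    omega
  · intro x hx
    simp only [List.mem_append] at hx
    rcases hx with h | h | h
    · exact ⟨x, ((hmemN x).2 (by simp [h])).1, Subgroup.mem_zpowers x⟩
    · exact ⟨t, ht, mem_zpowers_of_mem_splitList t m x h⟩
    · exact ⟨x, ((hmemN x).2 (by simp [h])).1, Subgroup.mem_zpowers x⟩

theorem mem_ramificationSizes_of_sq_ne_one [Nontrivial G]
    (hG : ∀ T : List G, IsLaxSystem T → ∃ t ∈ T, t ^ 2 ≠ 1) {r : ℕ × ℕ} (h : r ∈ laxSizes G) :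
    r ∈ ramificationSizes G := by
  obtain ⟨T₁, T₂, h, h₁, h₂⟩ := h
  obtain ⟨t₁, ht₁, hs₁⟩ := hG T₁ h.left
  obtain ⟨t₂, ht₂, hs₂⟩ := hG T₂ h.right
  obtain ⟨U₁, hU₁, n₁, l₁, z₁⟩ := exists_spherical_of_sq_ne_one h.left ht₁ hs₁
  obtain ⟨U₂, hU₂, n₂, l₂, z₂⟩ := exists_spherical_of_sq_ne_one h.right ht₂ hs₂
  exact mem_ramificationSizes_iff.2 ⟨U₁, U₂,
    ((h.replace_left hU₁ z₁).symm.replace_left hU₂ z₂).symm, n₁, n₂, l₁.trans h₁, l₂.trans h₂⟩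

end Split

/-! ### Products of groups of coprime orders. -/

section Product

theorem exists_list_map_eval {ι : Type*} {H : ι → Type*} [∀ i, Group (H i)] {r : ℕ}
    (T : ∀ i, List (H i)) (hT : ∀ i, (T i).length = r) :
    ∃ U : List (∀ i, H i), U.length = r ∧ ∀ i, U.map (Pi.evalMonoidHom H i) = T i := by
  refine ⟨List.ofFn fun (k : Fin r) i => (T i)[k]'(by rw [hT i]; exact k.2), by simp, fun i => ?_⟩
  apply List.ext_getElem <;> simp [hT i]

variable {ι : Type*} [Fintype ι] [DecidableEq ι] {H : ι → Type*} [∀ i, Group (H i)]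

/-- By the Chinese remainder theorem choose `m` congruent to 1 modulo the order of one factor and to
0 modulo the orders of the others. Projection to a coordinate thus stays inside cyclic subgroups. -/
theorem exists_pow_eq_mulSingle
    (hco : Pairwise fun i j => (Nat.card (H i)).Coprime (Nat.card (H j))) (i : ι) :
    ∃ m : ℕ, ∀ x : ∀ i, H i, x ^ m = Pi.mulSingle i (x i) := by
  have hc : (Nat.card (H i)).Coprime (∏ j ∈ Finset.univ.erase i, Nat.card (H j)) :=
    Nat.Coprime.prod_right fun j hj => hco (Finset.ne_of_mem_erase hj).symm
  obtain ⟨m, hm₁, hm₀⟩ := Nat.chineseRemainder hc 1 0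
  refine ⟨m, fun x => ?_⟩
  ext j
  by_cases hj : j = i
  · subst hj
    rw [Pi.mulSingle_eq_same, Pi.pow_apply]
    simpa using pow_eq_pow_iff_modEq.2 (hm₁.of_dvd (orderOf_dvd_natCard (x j)))
  · rw [Pi.mulSingle_eq_of_ne hj, Pi.pow_apply]
    refine orderOf_dvd_iff_pow_eq_one.1 ((orderOf_dvd_natCard _).trans ?_)
    exact (Finset.dvd_prod_of_mem (fun j => Nat.card (H j)) (by simp [hj])).trans
      ((Nat.modEq_zero_iff_dvd).1 hm₀)

/-- `Σ` is closed under powers, so an element of the projected `Σ`, placed in its coordinate, lies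
in the original `Σ`. -/
theorem IsLaxStructure.map_eval
    (hco : Pairwise fun i j => (Nat.card (H i)).Coprime (Nat.card (H j)))
    {T₁ T₂ : List (∀ i, H i)} (h : IsLaxStructure T₁ T₂) (i : ι) :
    IsLaxStructure (T₁.map (Pi.evalMonoidHom H i)) (T₂.map (Pi.evalMonoidHom H i)) := by
  have hs : Function.Surjective (Pi.evalMonoidHom H i) := Function.surjective_eval i
  refine ⟨h.left.map _ hs, h.right.map _ hs, ?_⟩
  obtain ⟨m, hm⟩ := exists_pow_eq_mulSingle hco i
  have key : ∀ (T : List (∀ i, H i)) (y : H i), y ∈ sigmaSet (T.map (Pi.evalMonoidHom H i)) →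
      Pi.mulSingle i y ∈ sigmaSet T := by
    rintro T y ⟨g, t, ht, z, ⟨n, rfl⟩, rfl⟩
    obtain ⟨s, hs, rfl⟩ := List.mem_map.1 ht
    have hmem : (Pi.mulSingle i g)⁻¹ * s ^ n * Pi.mulSingle i g ∈ sigmaSet T :=
      ⟨Pi.mulSingle i g, s, hs, s ^ n, ⟨n, rfl⟩, rfl⟩
    have := zpow_mem_sigmaSet hmem m
    rw [zpow_natCast, hm] at this
    simpa using this
  intro x h₁ h₂
  simpa using h.disjoint _ (key T₁ x h₁) (key T₂ x h₂)

theorem isLaxSystem_of_map_eval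
    (hco : Pairwise fun i j => (Nat.card (H i)).Coprime (Nat.card (H j)))
    {T : List (∀ i, H i)} (h : ∀ i, IsLaxSystem (T.map (Pi.evalMonoidHom H i))) :
    IsLaxSystem T := by
  constructor
  · refine top_le_iff.1 fun x _ => Subgroup.pi_mem_of_mulSingle_mem x fun i => ?_
    obtain ⟨m, hm⟩ := exists_pow_eq_mulSingle hco i
    have hx : x i ∈ (Subgroup.closure {t | t ∈ T}).map (Pi.evalMonoidHom H i) := by
      have := (h i).closure_eq_top
      rw [MonoidHom.map_closure]
      have e : (Pi.evalMonoidHom H i) '' {t | t ∈ T} =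
          {t | t ∈ T.map (Pi.evalMonoidHom H i)} := by ext; simp
      rw [e, this]
      trivial
    obtain ⟨k, hk, hkx⟩ := hx
    rw [← hkx]
    simpa [hm] using Subgroup.pow_mem _ hk m
  · ext i
    have := (h i).prod_eq_one
    rwa [List.prod_hom] at this

theorem isLaxStructure_of_map_eval
    (hco : Pairwise fun i j => (Nat.card (H i)).Coprime (Nat.card (H j)))
    {T₁ T₂ : List (∀ i, H i)}
    (h : ∀ i, IsLaxStructure (T₁.map (Pi.evalMonoidHom H i)) (T₂.map (Pi.evalMonoidHom H i))) :
    IsLaxStructure T₁ T₂ := by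
  refine ⟨isLaxSystem_of_map_eval hco fun i => (h i).left,
    isLaxSystem_of_map_eval hco fun i => (h i).right, fun x h₁ h₂ => ?_⟩
  ext i
  exact (h i).disjoint _ (map_mem_sigmaSet _ h₁) (map_mem_sigmaSet _ h₂)

theorem laxSizes_eval
    (hco : Pairwise fun i j => (Nat.card (H i)).Coprime (Nat.card (H j)))
    {r : ℕ × ℕ} (h : r ∈ laxSizes (∀ i, H i)) (i : ι) : r ∈ laxSizes (H i) := by
  obtain ⟨T₁, T₂, h, h₁, h₂⟩ := h
  exact ⟨_, _, h.map_eval hco i, by simpa, by simpa⟩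

/-- An element of the product is non-trivial as soon as its coordinate at `i₀` is; the other factors
may therefore contribute trivial entries. -/
theorem ramificationSizes_pi
    (hco : Pairwise fun i j => (Nat.card (H i)).Coprime (Nat.card (H j)))
    {r : ℕ × ℕ} (h : ∀ i, r ∈ laxSizes (H i)) (i₀ : ι) [Nontrivial (H i₀)]
    (h₀ : r ∈ ramificationSizes (H i₀)) : r ∈ ramificationSizes (∀ i, H i) := by
  have : Nontrivial (∀ i, H i) := (Function.surjective_eval (β := H) i₀).nontrivial
  obtain ⟨A, B, hAB, nA, nB, lA, lB⟩ := mem_ramificationSizes_iff.1 h₀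
  have h' : ∀ i, ∃ T : List (H i) × List (H i), IsLaxStructure T.1 T.2 ∧
      T.1.length = r.1 ∧ T.2.length = r.2 ∧ (i = i₀ → (∀ t ∈ T.1, t ≠ 1) ∧ ∀ t ∈ T.2, t ≠ 1) := by
    intro i
    by_cases hi : i = i₀
    · subst hi
      exact ⟨(A, B), hAB, lA, lB, fun _ => ⟨nA, nB⟩⟩
    · obtain ⟨T₁, T₂, h, h₁, h₂⟩ := h i
      exact ⟨(T₁, T₂), h, h₁, h₂, fun e => absurd e hi⟩
  choose T hT l₁ l₂ n using h'
  obtain ⟨U₁, e₁, m₁⟩ := exists_list_map_eval (fun i => (T i).1) l₁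
  obtain ⟨U₂, e₂, m₂⟩ := exists_list_map_eval (fun i => (T i).2) l₂
  have hne : ∀ U : List (∀ i, H i), (∀ t ∈ U.map (Pi.evalMonoidHom H i₀), t ≠ 1) →
      ∀ t ∈ U, t ≠ 1 := by
    rintro U hU t ht rfl
    exact hU _ (List.mem_map_of_mem ht) (map_one _)
  refine mem_ramificationSizes_iff.2 ⟨U₁, U₂, isLaxStructure_of_map_eval hco fun i => ?_,
    hne U₁ ?_, hne U₂ ?_, e₁, e₂⟩
  · rw [m₁, m₂]; exact hT i
  · rw [m₁]; exact (n i₀ rfl).1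
  · rw [m₂]; exact (n i₀ rfl).2

end Product

/-! ### Elementary abelian 2-groups. -/

section ExponentTwo

theorem exists_mulEquiv_of_forall_mul_self {A : Type*} [Group A] [Finite A]
    (hA : ∀ a : A, a * a = 1) :
    ∃ n : ℕ, Nonempty (A ≃* Multiplicative (Fin n → ZMod 2)) := by
  let : CommGroup A :=
    { ‹Group A› with
      mul_comm := fun a b => by
        have h := hA (a * b)
        rw [mul_eq_one_iff_eq_inv, mul_inv_rev, ← mul_eq_one_iff_eq_inv.1 (hA a),
          ← mul_eq_one_iff_eq_inv.1 (hA b)] at h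
        exact h }
  let : Module (ZMod 2) (Additive A) := AddCommGroup.zmodModule (n := 2) fun x => by
    rw [two_nsmul]; exact hA x
  exact ⟨_, ⟨AddEquiv.toMultiplicativeRight
    (Module.finBasis (ZMod 2) (Additive A)).equivFun.toAddEquiv⟩⟩

theorem natCard_multiplicative_fin_zmod_two (n : ℕ) :
    Nat.card (Multiplicative (Fin n → ZMod 2)) = 2 ^ n := by
  rw [Nat.card_congr Multiplicative.toAdd, Nat.card_eq_fintype_card]
  simp

theorem nonempty_mulEquiv_of_forall_mul_self {A B : Type*} [Group A] [Group B] [Finite A]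
    [Finite B] (hA : ∀ a : A, a * a = 1) (hB : ∀ b : B, b * b = 1)
    (h : Nat.card A = Nat.card B) : Nonempty (A ≃* B) := by
  obtain ⟨n, ⟨f⟩⟩ := exists_mulEquiv_of_forall_mul_self hA
  obtain ⟨m, ⟨g⟩⟩ := exists_mulEquiv_of_forall_mul_self hB
  rw [Nat.card_congr f.toEquiv, Nat.card_congr g.toEquiv, natCard_multiplicative_fin_zmod_two,
    natCard_multiplicative_fin_zmod_two] at h
  obtain rfl := Nat.pow_right_injective le_rfl h
  exact ⟨f.trans g.symm⟩

theorem zmod_two_function_mul_self (n : ℕ) (x : Multiplicative (Fin n → ZMod 2)) :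
    x * x = 1 := by
  ext i
  exact CharTwo.add_self_eq_zero (R := ZMod 2) _

variable {V : Type*} [CommGroup V]

theorem eq_one_or_mem_of_mem_sigmaSet (hV : ∀ v : V, v * v = 1) {T : List V} {x : V}
    (hx : x ∈ sigmaSet T) : x = 1 ∨ x ∈ T := by
  obtain ⟨g, t, ht, y, ⟨n, rfl⟩, rfl⟩ := hx
  simp only [inv_mul_cancel_comm]
  have h2 : t ^ (2 : ℤ) = 1 := by rw [zpow_two, hV]
  rcases Int.even_or_odd' n with ⟨k, rfl | rfl⟩
  · left; rw [zpow_mul, h2, one_zpow]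
  · right; simpa [zpow_add, zpow_mul, h2] using ht

theorem isLaxStructure_of_forall_mul_self (hV : ∀ v : V, v * v = 1) {T₁ T₂ : List V}
    (h₁ : IsLaxSystem T₁) (h₂ : IsLaxSystem T₂) (h : ∀ t ∈ T₁, t ∈ T₂ → t = 1) :
    IsLaxStructure T₁ T₂ := by
  refine ⟨h₁, h₂, fun x hx hx' => ?_⟩
  rcases eq_one_or_mem_of_mem_sigmaSet hV hx with rfl | hx
  · rfl
  rcases eq_one_or_mem_of_mem_sigmaSet hV hx' with rfl | hx'
  · rfl
  exact h x hx hx'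

/-- Turns generation into a finite check on subproducts, which `decide` can settle for explicit
tuples. -/
theorem isLaxSystem_of_sublists {T : List V}
    (h : ∀ x : V, ∃ l ∈ T.sublists, l.prod = x) (hp : T.prod = 1) : IsLaxSystem T := by
  refine ⟨top_le_iff.1 fun x _ => ?_, hp⟩
  obtain ⟨l, hl, rfl⟩ := h x
  exact Subgroup.list_prod_mem _ fun y hy =>
    Subgroup.subset_closure ((List.mem_sublists.1 hl).subset hy)

theorem le_card_of_closure_eq_top [Finite V] (hV : ∀ v : V, v * v = 1) {n : ℕ}
    (hn : Nat.card V = 2 ^ n) {S : Finset V} (hS : Subgroup.closure (S : Set V) = ⊤) :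
    n ≤ S.card := by
  have h := card_dvd_exponent_pow_rank' V (n := 2) fun v => by rw [pow_two, hV]
  rw [hn] at h
  exact ((Nat.pow_dvd_pow_iff_le_right one_lt_two).1 h).trans (Group.rank_le hS)

section Support

variable [DecidableEq V]

/-- The finset of non-trivial entries of a tuple. -/
def properEntries (T : List V) : Finset V := T.toFinset.erase 1

theorem mem_properEntries {T : List V} {x : V} : x ∈ properEntries T ↔ x ≠ 1 ∧ x ∈ T := by
  simp [properEntries]

theorem IsLaxSystem.closure_properEntries {T : List V} (hT : IsLaxSystem T) :
    Subgroup.closure (properEntries T : Set V) = ⊤ := by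
  rw [← top_le_iff, ← hT.closure_eq_top, Subgroup.closure_le]
  intro x hx
  by_cases h : x = 1
  · rw [h]; exact Subgroup.one_mem _
  · exact Subgroup.subset_closure (mem_properEntries.2 ⟨h, hx⟩)

theorem IsLaxStructure.disjoint_properEntries {T₁ T₂ : List V} (h : IsLaxStructure T₁ T₂) :
    Disjoint (properEntries T₁) (properEntries T₂) := by
  rw [Finset.disjoint_left]
  intro x h₁ h₂
  rw [mem_properEntries] at h₁ h₂
  exact h₁.1 (h.ne_of_mem h₁.2 h₂.2)

theorem IsLaxStructure.card_properEntries_lt [Finite V] {T₁ T₂ : List V}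
    (h : IsLaxStructure T₁ T₂) :
    (properEntries T₁).card + (properEntries T₂).card < Nat.card V := by
  have := Fintype.ofFinite V
  rw [← Finset.card_union_of_disjoint h.disjoint_properEntries, Nat.card_eq_fintype_card]
  refine Finset.card_lt_univ_of_notMem (x := 1) ?_
  simp [mem_properEntries]

/-- Two disjoint generating sets of non-trivial elements would need `2 * n < 2 ^ n`. -/
theorem laxSizes_eq_empty [Finite V] (hV : ∀ v : V, v * v = 1) {n : ℕ}
    (hn : Nat.card V = 2 ^ n) (hn₁ : 1 ≤ n) (hn₂ : n ≤ 2) (r : ℕ × ℕ) : r ∉ laxSizes V := by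
  rintro ⟨T₁, T₂, h, -, -⟩
  have h₁ := le_card_of_closure_eq_top hV hn h.left.closure_properEntries
  have h₂ := le_card_of_closure_eq_top hV hn h.right.closure_properEntries
  have h₃ := h.card_properEntries_lt
  rw [hn] at h₃
  interval_cases n <;> omega

/-- If the non-trivial entries form a basis, then each of them occurs an even number of times. -/
theorem even_count_of_card_properEntries [Finite V] (hV : ∀ v : V, v * v = 1) {n : ℕ}
    (hn : Nat.card V = 2 ^ n) {T : List V} (hT : IsLaxSystem T)
    (hc : (properEntries T).card = n) {x : V} (hx : x ∈ properEntries T) : Even (T.count x) := by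
  by_contra hodd
  rw [Nat.not_even_iff_odd] at hodd
  have hprod : ∏ m ∈ properEntries T, m ^ T.count m = 1 := by
    rw [← hT.prod_eq_one, Finset.prod_list_count, properEntries]
    exact Finset.prod_erase _ (one_pow _)
  have hpow : x ^ T.count x = x := by
    obtain ⟨k, hk⟩ := hodd
    rw [hk, pow_succ, pow_mul, pow_two, hV, one_pow, one_mul]
  -- With odd multiplicity the relation solves for `x` in terms of the other entries, leaving only
  -- `n - 1` generators.
  rw [← Finset.mul_prod_erase _ _ hx, hpow, mul_eq_one_iff_eq_inv] at hprod
  have hmem : x ∈ Subgroup.closure (((properEntries T).erase x : Finset V) : Set V) := by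
    have := Subgroup.inv_mem _ (Subgroup.prod_mem _ fun m hm =>
      Subgroup.pow_mem (Subgroup.closure (((properEntries T).erase x : Finset V) : Set V))
        (Subgroup.subset_closure hm) (T.count m))
    rwa [← hprod] at this
  have htop : Subgroup.closure (((properEntries T).erase x : Finset V) : Set V) = ⊤ := by
    rw [← top_le_iff, ← hT.closure_properEntries, Subgroup.closure_le]
    intro y hy
    by_cases hyx : y = x
    · rw [hyx]; exact hmem
    · exact Subgroup.subset_closure (by simpa [hyx] using hy)
  have := le_card_of_closure_eq_top hV hn htop
  have := Finset.card_erase_lt_of_mem hx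
  omega

theorem length_eq_sum_count (T : List V) :
    T.length = T.count 1 + ∑ x ∈ properEntries T, T.count x := by
  rw [← Multiset.coe_card, ← Multiset.toFinset_sum_count_eq]
  simp only [Multiset.coe_count]
  have : (T : Multiset V).toFinset = T.toFinset := by ext; simp
  rw [this, properEntries]
  by_cases h : (1 : V) ∈ T.toFinset
  · rw [Finset.add_sum_erase _ (fun x => T.count x) h]
  · rw [Finset.erase_eq_of_notMem h, List.count_eq_zero.2 (by simpa using h), zero_add]

theorem two_mul_le_length [Finite V] (hV : ∀ v : V, v * v = 1) {n : ℕ}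
    (hn : Nat.card V = 2 ^ n) {T : List V} (hT : IsLaxSystem T)
    (hc : (properEntries T).card = n) : 2 * n ≤ T.length := by
  rw [length_eq_sum_count]
  have : ∑ x ∈ properEntries T, 2 ≤ ∑ x ∈ properEntries T, T.count x := by
    refine Finset.sum_le_sum fun x hx => ?_
    have h₁ := even_count_of_card_properEntries hV hn hT hc hx
    have h₂ := List.count_pos_iff.2 (mem_properEntries.1 hx).2
    obtain ⟨k, hk⟩ := h₁
    omega
  rw [Finset.sum_const, hc, smul_eq_mul] at this
  omega

theorem even_length [Finite V] (hV : ∀ v : V, v * v = 1) {n : ℕ}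
    (hn : Nat.card V = 2 ^ n) {T : List V} (hT : IsLaxSystem T)
    (hc : (properEntries T).card = n) (h1 : ∀ t ∈ T, t ≠ 1) : Even T.length := by
  rw [length_eq_sum_count, List.count_eq_zero.2 fun h => h1 1 h rfl, zero_add]
  exact Finset.even_sum _ fun x hx => even_count_of_card_properEntries hV hn hT hc hx

end Support

/-- Passing from rank `n` to rank `n + 1`. -/
theorem ramificationSizes_prod_zmod_two [Finite V] (hV : ∀ v : V, v * v = 1)
    (hcard : 4 < Nat.card V) {r₁ r₂ : ℕ} (h : (r₁, r₂) ∈ ramificationSizes V) :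
    (r₁ + 1, r₂ + 1) ∈ ramificationSizes (V × Multiplicative (ZMod 2)) := by
  classical
  have : Nontrivial V := Finite.one_lt_card_iff_nontrivial.1 (by omega)
  obtain ⟨T₁, T₂, h, n₁, n₂, e₁, e₂⟩ := mem_ramificationSizes_iff.1 h
  obtain ⟨t, l, rfl⟩ := List.exists_cons_of_ne_nil h.left.ne_nil
  obtain ⟨s, m, rfl⟩ := List.exists_cons_of_ne_nil h.right.ne_nil
  have hc : ∀ c : Multiplicative (ZMod 2), c * c = 1 := by decide
  set c : Multiplicative (ZMod 2) := Multiplicative.ofAdd 1 with hcdef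
  have hc1 : c ≠ 1 := by decide
  have hcx : ∀ y : Multiplicative (ZMod 2), y = 1 ∨ y = c := by decide
  -- The new entries with second coordinate `c` will be `t`, `1` on one side and `u`, `u * s` on the
  -- other. They are disjoint exactly when `u` avoids these four elements.
  obtain ⟨u, hu⟩ : ∃ u : V, u ∉ ({1, t, s, t * s} : Finset V) := by
    by_contra! hall
    have := Fintype.ofFinite V
    have h4 := Finset.card_le_four (a := (1 : V)) (b := t) (c := s) (d := t * s)
    rw [Finset.eq_univ_of_forall hall, Finset.card_univ, ← Nat.card_eq_fintype_card] at h4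
    omega
  simp only [Finset.mem_insert, Finset.mem_singleton, not_or] at hu
  have hV' : ∀ v : V × Multiplicative (ZMod 2), v * v = 1 := fun v => Prod.ext (hV _) (hc _)
  -- Split the first entry of a tuple along the new direction.
  have key : ∀ (a b : V) (k : List V), IsLaxSystem (a * b :: k) →
      IsLaxSystem ((a, c) :: (b, c) :: k.map (MonoidHom.inl V (Multiplicative (ZMod 2)))) := by
    intro a b k hk
    set U := (a, c) :: (b, c) :: k.map (MonoidHom.inl V (Multiplicative (ZMod 2))) with hU
    have hmem : ∀ x ∈ U, x ∈ Subgroup.closure {x | x ∈ U} := fun x hx =>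
      Subgroup.subset_closure hx
    have hinl : ∀ v : V, (v, 1) ∈ Subgroup.closure {x | x ∈ U} := by
      have : Subgroup.closure {x | x ∈ a * b :: k} ≤
          (Subgroup.closure {x | x ∈ U}).comap (MonoidHom.inl V (Multiplicative (ZMod 2))) := by
        rw [Subgroup.closure_le]
        intro x hx
        rcases List.mem_cons.1 hx with rfl | hx
        · have := Subgroup.mul_mem _ (hmem (a, c) (by simp [hU])) (hmem (b, c) (by simp [hU]))
          simpa [hc] using this
        · exact hmem _ (by simp [hU, hx])
      rw [hk.closure_eq_top] at this
      exact fun v => this trivial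
    refine ⟨top_le_iff.1 ?_, ?_⟩
    · rintro ⟨x, y⟩ -
      rcases hcx y with rfl | rfl
      · exact hinl x
      · have := Subgroup.mul_mem _ (hinl (x * a⁻¹)) (hmem (a, c) (by simp [hU]))
        simpa using this
    · have := hk.prod_eq_one
      rw [List.prod_cons] at this
      rw [hU, List.prod_cons, List.prod_cons, List.prod_hom, ← mul_assoc]
      ext
      · simpa using this
      · simp [hc]
  have hts : t ≠ s := by
    rintro rfl
    exact n₁ t (by simp) (h.ne_of_mem (t := t) (by simp) (by simp))
  refine mem_ramificationSizes_iff.2 ⟨_, _, isLaxStructure_of_forall_mul_self hV'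
    (key t 1 l (by simpa using h.left)) (key u (u * s) m ?_) ?_, ?_, ?_, ?_, ?_⟩
  · rw [← mul_assoc, hV, one_mul]; exact h.right
  · intro x hx hx'
    simp only [List.mem_cons, List.mem_map, MonoidHom.inl_apply] at hx hx'
    rcases hx with rfl | rfl | ⟨a, ha, rfl⟩ <;> rcases hx' with hx' | hx' | ⟨b, hb, hx'⟩ <;>
      simp only [Prod.mk.injEq] at hx'
    · exact absurd hx'.1.symm hu.2.1
    · refine absurd ?_ hu.2.2.2
      rw [hx'.1, mul_assoc, hV, mul_one]
    · exact absurd hx'.2.symm hc1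
    · exact absurd hx'.1.symm hu.1
    · refine absurd ?_ hu.2.2.1
      rw [← one_mul s, hx'.1, mul_assoc, hV, mul_one]
    · exact absurd hx'.2.symm hc1
    · exact absurd hx'.2.symm hc1
    · exact absurd hx'.2.symm hc1
    · obtain ⟨rfl, -⟩ := hx'
      rw [h.ne_of_mem (List.mem_cons_of_mem _ ha) (List.mem_cons_of_mem _ hb)]
      rfl
  · intro x hx
    simp only [List.mem_cons, List.mem_map, MonoidHom.inl_apply] at hx
    rcases hx with rfl | rfl | ⟨a, ha, rfl⟩
    · simp [Prod.ext_iff, hc1]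
    · simp [Prod.ext_iff, hc1]
    · simpa [Prod.ext_iff] using n₁ a (by simp [ha])
  · intro x hx
    simp only [List.mem_cons, List.mem_map, MonoidHom.inl_apply] at hx
    rcases hx with rfl | rfl | ⟨a, ha, rfl⟩
    · simp [Prod.ext_iff, hc1]
    · simp [Prod.ext_iff, hc1]
    · simpa [Prod.ext_iff] using n₂ a (by simp [ha])
  · simpa using e₁
  · simpa using e₂

end ExponentTwo

/-! ### Rank three, and rank at least four. -/

section SmallRank

theorem natCard_c2Cubed : Nat.card C2Cubed = 2 ^ 3 := by
  rw [Nat.card_eq_fintype_card]; rfl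

theorem c2Cubed_mul_self : ∀ x : C2Cubed, x * x = 1 := by decide

/-- A tuple of length at most 4 cannot have a basis as its non-trivial entries, so it consists of
four distinct non-trivial elements with product 1. The other tuple then uses exactly the remaining
three. All seven multiply to 1, so those three do as well, which is impossible for a basis. -/
theorem IsLaxStructure.five_le_length {T₁ T₂ : List C2Cubed} (h : IsLaxStructure T₁ T₂) :
    5 ≤ T₁.length := by
  by_contra! hlt
  have h₁ := le_card_of_closure_eq_top c2Cubed_mul_self natCard_c2Cubed
    h.left.closure_properEntries
  have h₂ := le_card_of_closure_eq_top c2Cubed_mul_self natCard_c2Cubed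
    h.right.closure_properEntries
  have h₃ := h.card_properEntries_lt
  rw [natCard_c2Cubed] at h₃
  have h₄ : (properEntries T₁).card ≠ 3 := fun hc => by
    have := two_mul_le_length c2Cubed_mul_self natCard_c2Cubed h.left hc
    omega
  have hsub : properEntries T₁ ⊆ T₁.toFinset := Finset.erase_subset _ _
  have h₅ := Finset.card_le_card hsub
  have h₆ := T₁.toFinset_card_le
  have heq : properEntries T₁ = T₁.toFinset := Finset.eq_of_subset_of_card_le hsub (by omega)
  have hnd : T₁.Nodup := by
    rw [← Multiset.coe_nodup, ← Multiset.toFinset_card_eq_card_iff_nodup, Multiset.coe_card]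
    change T₁.toFinset.card = _
    omega
  have hprod₁ : ∏ x ∈ properEntries T₁, x = 1 := by
    rw [heq, List.prod_toFinset _ hnd, List.map_id', h.left.prod_eq_one]
  have huniv : properEntries T₁ ∪ properEntries T₂ = Finset.univ.erase 1 := by
    refine Finset.eq_of_subset_of_card_le (fun x hx => ?_) ?_
    · have : x ≠ 1 := by
        rcases Finset.mem_union.1 hx with hx | hx <;> exact (mem_properEntries.1 hx).1
      simp [this]
    · rw [Finset.card_union_of_disjoint h.disjoint_properEntries,
        show (Finset.univ.erase (1 : C2Cubed)).card = 7 from by decide]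
      omega
  have hprod₂ : ∏ x ∈ properEntries T₂, x = 1 := by
    have hall : ∏ x ∈ Finset.univ.erase (1 : C2Cubed), x = 1 := by decide
    rwa [← huniv, Finset.prod_union h.disjoint_properEntries, hprod₁, one_mul] at hall
  have hlax : IsLaxSystem (properEntries T₂).toList := by
    refine ⟨?_, ?_⟩
    · simpa using h.right.closure_properEntries
    · rw [← hprod₂, Finset.prod_toList]
  have hself : properEntries (properEntries T₂).toList = properEntries T₂ := by
    ext x
    simp only [mem_properEntries, Finset.mem_toList]
    tauto
  have := two_mul_le_length c2Cubed_mul_self natCard_c2Cubed hlax (by rw [hself]; omega)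
  rw [Finset.length_toList] at this
  omega

theorem IsLaxStructure.card_properEntries_c2Cubed {T₁ T₂ : List C2Cubed}
    (h : IsLaxStructure T₁ T₂) :
    (properEntries T₁).card = 3 ∨ (properEntries T₂).card = 3 := by
  have h₁ := le_card_of_closure_eq_top c2Cubed_mul_self natCard_c2Cubed
    h.left.closure_properEntries
  have h₂ := le_card_of_closure_eq_top c2Cubed_mul_self natCard_c2Cubed
    h.right.closure_properEntries
  have h₃ := h.card_properEntries_lt
  rw [natCard_c2Cubed] at h₃
  omega

theorem five_le_of_mem_laxSizes_c2Cubed {r₁ r₂ : ℕ} (h : (r₁, r₂) ∈ laxSizes C2Cubed) :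
    5 ≤ r₁ ∧ 5 ≤ r₂ ∧ (r₁, r₂) ≠ (5, 5) := by
  obtain ⟨T₁, T₂, h, rfl, rfl⟩ := h
  refine ⟨h.five_le_length, h.symm.five_le_length, fun he => ?_⟩
  rw [Prod.mk.injEq] at he
  rcases h.card_properEntries_c2Cubed with hc | hc
  · have := two_mul_le_length c2Cubed_mul_self natCard_c2Cubed h.left hc
    omega
  · have := two_mul_le_length c2Cubed_mul_self natCard_c2Cubed h.right hc
    omega

theorem not_odd_of_mem_ramificationSizes_c2Cubed {r₁ r₂ : ℕ}
    (h : (r₁, r₂) ∈ ramificationSizes C2Cubed) : ¬(Odd r₁ ∧ Odd r₂) := by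
  obtain ⟨T₁, T₂, hT, n₁, n₂, rfl, rfl⟩ := mem_ramificationSizes_iff.1 h
  rintro ⟨o₁, o₂⟩
  rcases hT.card_properEntries_c2Cubed with hc | hc
  · exact Nat.not_even_iff_odd.2 o₁ (even_length c2Cubed_mul_self natCard_c2Cubed hT.left hc n₁)
  · exact Nat.not_even_iff_odd.2 o₂ (even_length c2Cubed_mul_self natCard_c2Cubed hT.right hc n₂)

/-- The generator of the multiplicative group of order two. -/
abbrev gen₂ : Multiplicative (ZMod 2) := Multiplicative.ofAdd 1

/-- The second tuple doubles a basis. Of the other four non-trivial elements, three multiply to 1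
and the last is doubled. -/
theorem five_six_mem_ramificationSizes_c2Cubed : (5, 6) ∈ ramificationSizes C2Cubed := by
  refine mem_ramificationSizes_iff.2
    ⟨[(gen₂, gen₂, 1), (1, gen₂, gen₂), (gen₂, 1, gen₂), (gen₂, gen₂, gen₂), (gen₂, gen₂, gen₂)],
    [(gen₂, 1, 1), (gen₂, 1, 1), (1, gen₂, 1), (1, gen₂, 1), (1, 1, gen₂), (1, 1, gen₂)],
    isLaxStructure_of_forall_mul_self c2Cubed_mul_self
      (isLaxSystem_of_sublists (by decide +kernel) (by decide))
      (isLaxSystem_of_sublists (by decide +kernel) (by decide)) (by decide),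
    by decide, by decide, rfl, rfl⟩

theorem six_six_mem_ramificationSizes_c2Cubed : (6, 6) ∈ ramificationSizes C2Cubed := by
  refine mem_ramificationSizes_iff.2
    ⟨[(gen₂, gen₂, 1), (gen₂, gen₂, 1), (1, gen₂, gen₂), (1, gen₂, gen₂),
      (gen₂, gen₂, gen₂), (gen₂, gen₂, gen₂)],
    [(gen₂, 1, 1), (gen₂, 1, 1), (1, gen₂, 1), (1, gen₂, 1), (1, 1, gen₂), (1, 1, gen₂)],
    isLaxStructure_of_forall_mul_self c2Cubed_mul_self
      (isLaxSystem_of_sublists (by decide +kernel) (by decide))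
      (isLaxSystem_of_sublists (by decide +kernel) (by decide)) (by decide),
    by decide, by decide, rfl, rfl⟩

theorem mem_ramificationSizes_c2Cubed {r₁ r₂ : ℕ} (h₁ : 5 ≤ r₁) (h₂ : 5 ≤ r₂)
    (hodd : ¬(Odd r₁ ∧ Odd r₂)) : (r₁, r₂) ∈ ramificationSizes C2Cubed := by
  have key : ∀ {r₁ r₂ : ℕ}, 5 ≤ r₁ → 5 ≤ r₂ → Even r₂ →
      (r₁, r₂) ∈ ramificationSizes C2Cubed := by
    intro r₁ r₂ h₁ h₂ he
    obtain ⟨b, rfl⟩ := he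
    rcases Nat.even_or_odd' r₁ with ⟨a, rfl | rfl⟩
    · convert ramificationSizes_add_even (a - 3) (b - 3) six_six_mem_ramificationSizes_c2Cubed
        using 2 <;> omega
    · convert ramificationSizes_add_even (a - 2) (b - 3) five_six_mem_ramificationSizes_c2Cubed
        using 2 <;> omega
  by_cases he : Even r₂
  · exact key h₁ h₂ he
  · refine ramificationSizes_swap (key h₂ h₁ ?_)
    by_contra he'
    exact hodd ⟨Nat.not_even_iff_odd.1 he', Nat.not_even_iff_odd.1 he⟩

theorem IsLaxSystem.append_one {G : Type*} [Group G] {T : List G} (hT : IsLaxSystem T) (k : ℕ) :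
    IsLaxSystem (T ++ List.replicate k 1) := by
  refine ⟨top_le_iff.1 (hT.closure_eq_top.symm.le.trans (Subgroup.closure_mono ?_)), ?_⟩
  · intro x (hx : x ∈ T)
    simp [hx]
  · simp [hT.prod_eq_one]

theorem laxSizes_mono {G : Type*} [Group G] [Nontrivial G] {r₁ r₂ s₁ s₂ : ℕ}
    (h : (r₁, r₂) ∈ laxSizes G) (h₁ : r₁ ≤ s₁) (h₂ : r₂ ≤ s₂) : (s₁, s₂) ∈ laxSizes G := by
  have key : ∀ {r₁ r₂ s₁ : ℕ}, (r₁, r₂) ∈ laxSizes G → r₁ ≤ s₁ → (s₁, r₂) ∈ laxSizes G := by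
    rintro r₁ r₂ s₁ ⟨T₁, T₂, h, rfl, rfl⟩ hs
    refine ⟨T₁ ++ List.replicate (s₁ - T₁.length) 1, T₂, h.replace_left (h.left.append_one _) ?_,
      by simp at hs ⊢; omega, rfl⟩
    obtain ⟨t, ht⟩ := List.exists_mem_of_ne_nil T₁ h.left.ne_nil
    intro x hx
    rcases List.mem_append.1 hx with hx | hx
    · exact ⟨x, hx, Subgroup.mem_zpowers x⟩
    · rw [List.eq_of_mem_replicate hx]
      exact ⟨t, ht, Subgroup.one_mem _⟩
  exact laxSizes_swap (key (laxSizes_swap (key h h₁)) h₂)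

/-- Padding by 1 increases either length by one, so size `(5, 6)` and its swap give everything and
parity plays no role. -/
theorem mem_laxSizes_c2Cubed {r₁ r₂ : ℕ} (h₁ : 5 ≤ r₁) (h₂ : 5 ≤ r₂)
    (h : (r₁, r₂) ≠ (5, 5)) : (r₁, r₂) ∈ laxSizes C2Cubed := by
  have h56 := mem_laxSizes_of_mem_ramificationSizes five_six_mem_ramificationSizes_c2Cubed
  by_cases h6 : 6 ≤ r₂
  · exact laxSizes_mono h56 h₁ h6
  · refine laxSizes_mono (laxSizes_swap h56) ?_ h₂
    by_contra h6'
    exact h (by ext <;> simp <;> omega)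

/-- The elementary abelian group of order sixteen. -/
abbrev C2Fourth : Type := Multiplicative (ZMod 2) × C2Cubed

theorem c2Fourth_mul_self : ∀ x : C2Fourth, x * x = 1 := by decide

theorem mem_ramificationSizes_c2Fourth {r₁ r₂ : ℕ} (h₁ : 5 ≤ r₁) (h₂ : 5 ≤ r₂) :
    (r₁, r₂) ∈ ramificationSizes C2Fourth := by
  -- One tuple of each parity on each side, every `A` being disjoint from every `B`; inverse pairs
  -- then supply all larger lengths. `A₅` is a basis together with its product, and `A₆` doubles one
  -- basis vector and adds the product of the other three.
  let A₅ : List C2Fourth := [(gen₂, 1, 1, 1), (1, gen₂, 1, 1), (1, 1, gen₂, 1), (1, 1, 1, gen₂),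
    (gen₂, gen₂, gen₂, gen₂)]
  let A₆ : List C2Fourth := [(gen₂, 1, 1, 1), (gen₂, 1, 1, 1), (1, gen₂, 1, 1), (1, 1, gen₂, 1),
    (1, 1, 1, gen₂), (1, gen₂, gen₂, gen₂)]
  let B₅ : List C2Fourth := [(gen₂, gen₂, 1, 1), (gen₂, 1, gen₂, 1), (1, 1, gen₂, gen₂),
    (gen₂, 1, gen₂, gen₂), (gen₂, gen₂, gen₂, 1)]
  let B₆ : List C2Fourth := [(gen₂, gen₂, 1, 1), (gen₂, 1, gen₂, 1), (1, 1, gen₂, gen₂),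
    (gen₂, 1, gen₂, gen₂), (gen₂, 1, gen₂, gen₂), (1, gen₂, 1, gen₂)]
  have hA₅ : IsLaxSystem A₅ := isLaxSystem_of_sublists (by decide +kernel) (by decide)
  have hA₆ : IsLaxSystem A₆ := isLaxSystem_of_sublists (by decide +kernel) (by decide)
  have hB₅ : IsLaxSystem B₅ := isLaxSystem_of_sublists (by decide +kernel) (by decide)
  have hB₆ : IsLaxSystem B₆ := isLaxSystem_of_sublists (by decide +kernel) (by decide)
  have hmem : ∀ A B : List C2Fourth, IsLaxSystem A → IsLaxSystem B → (∀ t ∈ A, t ∈ B → t = 1) →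
      (∀ t ∈ A, t ≠ 1) → (∀ t ∈ B, t ≠ 1) → ∀ k l : ℕ,
      (A.length + 2 * k, B.length + 2 * l) ∈ ramificationSizes C2Fourth :=
    fun A B hA hB hAB nA nB k l => ramificationSizes_add_even k l (mem_ramificationSizes_iff.2
      ⟨A, B, isLaxStructure_of_forall_mul_self c2Fourth_mul_self hA hB hAB, nA, nB, rfl, rfl⟩)
  rcases Nat.even_or_odd' r₁ with ⟨a, rfl | rfl⟩ <;> rcases Nat.even_or_odd' r₂ with ⟨b, rfl | rfl⟩
  · convert hmem A₆ B₆ hA₆ hB₆ (by decide) (by decide) (by decide) (a - 3) (b - 3) using 2 <;>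
      simp [A₆, B₆] <;> omega
  · convert hmem A₆ B₅ hA₆ hB₅ (by decide) (by decide) (by decide) (a - 3) (b - 2) using 2 <;>
      simp [A₆, B₅] <;> omega
  · convert hmem A₅ B₆ hA₅ hB₆ (by decide) (by decide) (by decide) (a - 2) (b - 3) using 2 <;>
      simp [A₅, B₆] <;> omega
  · convert hmem A₅ B₅ hA₅ hB₅ (by decide) (by decide) (by decide) (a - 2) (b - 2) using 2 <;>
      simp [A₅, B₅] <;> omega

theorem nontrivial_of_natCard {V : Type*} {n : ℕ} (hn : 1 ≤ n) (h : Nat.card V = 2 ^ n) :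
    Nontrivial V := by
  have : 1 < Nat.card V := by rw [h]; exact Nat.one_lt_two_pow (by omega)
  have := Nat.finite_of_card_ne_zero (α := V) (by omega)
  exact Finite.one_lt_card_iff_nontrivial.1 ‹_›

theorem mem_ramificationSizes_fin_zmod_two {n : ℕ} (hn : 4 ≤ n) :
    ∀ {r₁ r₂ : ℕ}, n + 1 ≤ r₁ → n + 1 ≤ r₂ →
      (r₁, r₂) ∈ ramificationSizes (Multiplicative (Fin n → ZMod 2)) := by
  induction n, hn using Nat.le_induction with
  | base =>
    intro r₁ r₂ h₁ h₂
    obtain ⟨φ⟩ := nonempty_mulEquiv_of_forall_mul_self c2Fourth_mul_self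
      (zmod_two_function_mul_self 4)
      (by rw [natCard_multiplicative_fin_zmod_two, Nat.card_eq_fintype_card]; rfl)
    exact ramificationSizes_of_mulEquiv φ (mem_ramificationSizes_c2Fourth h₁ h₂)
  | succ n hn ih =>
    intro r₁ r₂ h₁ h₂
    have hcard := natCard_multiplicative_fin_zmod_two n
    have hle : 2 ^ 4 ≤ 2 ^ n := Nat.pow_le_pow_right (by norm_num) hn
    have := nontrivial_of_natCard (by omega) hcard
    have hmem := ramificationSizes_prod_zmod_two (zmod_two_function_mul_self n) (by omega)
      (ih (r₁ := r₁ - 1) (r₂ := r₂ - 1) (by omega) (by omega))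
    rw [Nat.sub_add_cancel (by omega), Nat.sub_add_cancel (by omega)] at hmem
    have h2 : ∀ c : Multiplicative (ZMod 2), c * c = 1 := by decide
    obtain ⟨φ⟩ := nonempty_mulEquiv_of_forall_mul_self
      (A := Multiplicative (Fin n → ZMod 2) × Multiplicative (ZMod 2))
      (fun v => Prod.ext (zmod_two_function_mul_self n v.1) (h2 v.2))
      (zmod_two_function_mul_self (n + 1))
      (by
        rw [Nat.card_prod, hcard, natCard_multiplicative_fin_zmod_two, pow_succ,
          Nat.card_eq_fintype_card (α := Multiplicative (ZMod 2))]
        rfl)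
    exact ramificationSizes_of_mulEquiv φ hmem

end SmallRank

/-! ### From lax to proper structures in `p`-groups. -/

section PGroup

variable {H : Type*} [Group H] [Nontrivial H]

theorem IsLaxSystem.exists_ne_one {T : List H} (hT : IsLaxSystem T) : ∃ t ∈ T, t ≠ 1 := by
  by_contra! h
  have : Subgroup.closure {t : H | t ∈ T} ≤ ⊥ := by
    rw [Subgroup.closure_le]
    exact fun t ht => Subgroup.mem_bot.2 (h t ht)
  rw [hT.closure_eq_top] at this
  exact top_ne_bot (le_bot_iff.1 this)

theorem mem_ramificationSizes_of_isPGroup_odd {p : ℕ} [Fact p.Prime] (hp : p ≠ 2)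
    (hH : IsPGroup p H) {r : ℕ × ℕ} (h : r ∈ laxSizes H) : r ∈ ramificationSizes H := by
  refine mem_ramificationSizes_of_sq_ne_one (fun T hT => ?_) h
  obtain ⟨t, ht, ht1⟩ := hT.exists_ne_one
  refine ⟨t, ht, fun h2 => ht1 ?_⟩
  obtain ⟨k, hk⟩ := hH.exists_orderOf_eq_pow t
  have hcop : (orderOf t).Coprime 2 := by
    rw [hk]
    exact Nat.Coprime.pow_left _ ((Nat.coprime_primes Fact.out Nat.prime_two).2 hp)
  exact orderOf_eq_one_iff.1 (Nat.Coprime.eq_one_of_dvd hcop (orderOf_dvd_of_pow_eq_one h2))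

theorem mem_ramificationSizes_of_exponent_two_pow [Finite H] {e : ℕ} (hexp : Monoid.exponent H = 2 ^ e)
    (hsemi : IsSemiAbelian (2 ^ (e - 1)) H) (hc : ¬Nonempty (H ≃* C2Cubed)) {r : ℕ × ℕ}
    (h : r ∈ laxSizes H) : r ∈ ramificationSizes H := by
  have he0 : e ≠ 0 := by
    rintro rfl
    rw [pow_zero, Monoid.exp_eq_one_iff] at hexp
    exact not_subsingleton H hexp
  by_cases he : e = 1
  · subst he
    have hsq : ∀ x : H, x * x = 1 := fun x => by
      have := Monoid.pow_exponent_eq_one x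
      rwa [hexp, pow_one, pow_two] at this
    obtain ⟨n, ⟨φ⟩⟩ := exists_mulEquiv_of_forall_mul_self hsq
    have hcard := natCard_multiplicative_fin_zmod_two n
    have hV := zmod_two_function_mul_self n
    have hn0 : n ≠ 0 := by
      rintro rfl
      exact not_subsingleton H φ.toEquiv.subsingleton
    have hlax := laxSizes_of_mulEquiv φ h
    rcases lt_trichotomy n 3 with hn | rfl | hn
    · exact absurd hlax (laxSizes_eq_empty hV hcard (by omega) (by omega) r)
    · obtain ⟨ψ⟩ := nonempty_mulEquiv_of_forall_mul_self hV c2Cubed_mul_self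
        (hcard.trans natCard_c2Cubed.symm)
      exact absurd ⟨φ.trans ψ⟩ hc
    · have := nontrivial_of_natCard (by omega) hcard
      obtain ⟨T₁, T₂, hT, h₁, h₂⟩ := hlax
      have hrank : n ≤ Group.rank (Multiplicative (Fin n → ZMod 2)) := by
        have h := card_dvd_exponent_pow_rank' (Multiplicative (Fin n → ZMod 2)) (n := 2)
          fun v => by rw [pow_two, hV]
        rw [hcard] at h
        exact (Nat.pow_dvd_pow_iff_le_right one_lt_two).1 h
      have l₁ := rank_lt_length hT.left
      have l₂ := rank_lt_length hT.right
      exact ramificationSizes_of_mulEquiv φ.symm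
        (mem_ramificationSizes_fin_zmod_two hn (r₁ := r.1) (r₂ := r.2) (by omega) (by omega))
  · refine mem_ramificationSizes_of_sq_ne_one (fun T hT => ?_) h
    by_contra! hall
    -- The semi-abelian condition makes this set closed under division. As `e ≥ 2`, entries of order
    -- at most 2 all lie in it, and since they generate, the exponent would drop below `2 ^ e`.
    let Ω : Subgroup H := Subgroup.ofDiv {x | x ^ 2 ^ (e - 1) = 1} ⟨1, one_pow _⟩
      fun x hx y hy => (hsemi x y).1 (hx.trans hy.symm)
    have htop : ∀ x : H, x ^ 2 ^ (e - 1) = 1 := by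
      have hle : Subgroup.closure {t : H | t ∈ T} ≤ Ω := by
        rw [Subgroup.closure_le]
        intro t ht
        obtain ⟨k, rfl⟩ : ∃ k, e = k + 2 := ⟨e - 2, by omega⟩
        change t ^ 2 ^ (k + 1) = 1
        rw [pow_succ', pow_mul, hall t ht, one_pow]
      rw [hT.closure_eq_top] at hle
      exact fun x => hle trivial
    have := Monoid.exponent_dvd_of_forall_pow_eq_one htop
    rw [hexp, Nat.pow_dvd_pow_iff_le_right one_lt_two] at this
    omega

end PGroup

/-! ### Decomposition into Sylow subgroups. -/

section Nilpotent

variable {G : Type*} [Group G] [Finite G] (P : ∀ p : ℕ, Sylow p G)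

theorem nontrivial_sylow {p : ℕ} (hp : p.Prime) (hdvd : p ∣ Nat.card G) : Nontrivial (P p) := by
  have : Fact p.Prime := ⟨hp⟩
  exact (Subgroup.nontrivial_iff_ne_bot _).2 ((P p).ne_bot_of_dvd_card hdvd)

theorem pairwise_coprime_card_sylow :
    Pairwise fun i j : (Nat.card G).primeFactors =>
      (Nat.card (P i)).Coprime (Nat.card (P j)) := by
  intro i j hij
  have : Fact (i : ℕ).Prime := ⟨Nat.prime_of_mem_primeFactors i.2⟩
  have : Fact (j : ℕ).Prime := ⟨Nat.prime_of_mem_primeFactors j.2⟩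
  exact IsPGroup.coprime_card_of_ne i j (fun h => hij (Subtype.ext h)) _ _
    (P i).isPGroup' (P j).isPGroup'

variable [Group.IsNilpotent G]

theorem nonempty_pi_sylow_mulEquiv :
    Nonempty ((∀ p : (Nat.card G).primeFactors, P p) ≃* G) := by
  refine ⟨MulEquiv.trans ?_ (Sylow.directProductOfNormal (G := G) fun Q => inferInstance)⟩
  refine MulEquiv.piCongrRight fun p => ?_
  have : Fact (p : ℕ).Prime := ⟨Nat.prime_of_mem_primeFactors p.2⟩
  have := (Sylow.unique_of_normal (P p) inferInstance)
  letI : Unique (Sylow p G) := ⟨⟨P p⟩, fun Q => Subsingleton.elim _ _⟩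
  exact (MulEquiv.piUnique fun Q : Sylow p G => Q).symm

theorem laxSizes_sylow {r : ℕ × ℕ} (h : r ∈ laxSizes G) {p : ℕ} (hp : p.Prime)
    (hdvd : p ∣ Nat.card G) : r ∈ laxSizes (P p) := by
  obtain ⟨φ⟩ := nonempty_pi_sylow_mulEquiv P
  exact laxSizes_eval (pairwise_coprime_card_sylow P) (laxSizes_of_mulEquiv φ.symm h)
    ⟨p, Nat.mem_primeFactors.2 ⟨hp, hdvd, Nat.card_pos.ne'⟩⟩

theorem ramificationSizes_of_sylow {r : ℕ × ℕ}
    (h : ∀ p : ℕ, p.Prime → p ∣ Nat.card G → r ∈ laxSizes (P p)) {q : ℕ} (hq : q.Prime)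
    (hdvd : q ∣ Nat.card G) (h₀ : r ∈ ramificationSizes (P q)) : r ∈ ramificationSizes G := by
  obtain ⟨φ⟩ := nonempty_pi_sylow_mulEquiv P
  have := nontrivial_sylow P hq hdvd
  let i₀ : (Nat.card G).primeFactors := ⟨q, Nat.mem_primeFactors.2 ⟨hq, hdvd, Nat.card_pos.ne'⟩⟩
  have : Nontrivial (P i₀) := this
  have : Nontrivial (∀ p : (Nat.card G).primeFactors, P p) :=
    (Function.surjective_eval (β := fun p : (Nat.card G).primeFactors => P p) i₀).nontrivial
  exact ramificationSizes_of_mulEquiv φ (ramificationSizes_pi (pairwise_coprime_card_sylow P)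
    (fun i => h i (Nat.prime_of_mem_primeFactors i.2) (Nat.dvd_of_mem_primeFactors i.2)) i₀ h₀)

end Nilpotent

/-! ### The main theorem. -/

theorem theoremB {G : Type*} [Group G] [Finite G] [Nontrivial G] [Group.IsNilpotent G]
    (P : ∀ p : ℕ, Sylow p G) (e : ℕ → ℕ)
    (hexp : ∀ p : ℕ, p.Prime → p ∣ Nat.card G → Monoid.exponent (P p) = p ^ e p)
    (hsemi : ∀ p : ℕ, p.Prime → p ∣ Nat.card G → IsSemiAbelian (p ^ (e p - 1)) (P p)) :
    (HasRamificationStructure G ↔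
      ∀ p : ℕ, p.Prime → p ∣ Nat.card G → HasRamificationStructure (P p)) ∧
    ∀ r₁ r₂ : ℕ, (r₁, r₂) ∈ ramificationSizes G ↔
      (Group.rank G + 1 ≤ r₁ ∧ Group.rank G + 1 ≤ r₂) ∧
      (∀ p : ℕ, p.Prime → p ∣ Nat.card G → p ≠ 2 → (r₁, r₂) ∈ ramificationSizes (P p)) ∧
      (2 ∣ Nat.card G → ¬ Nonempty (P 2 ≃* C2Cubed) → (r₁, r₂) ∈ ramificationSizes (P 2)) ∧
      (Nonempty (P 2 ≃* C2Cubed) →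
        5 ≤ r₁ ∧ 5 ≤ r₂ ∧ (r₁, r₂) ≠ (5, 5) ∧
        (Nonempty (G ≃* C2Cubed) → ¬ (Odd r₁ ∧ Odd r₂))) := by
  have two_dvd : Nonempty (P 2 ≃* C2Cubed) → 2 ∣ Nat.card G := by
    rintro ⟨φ⟩
    refine dvd_trans ?_ (Subgroup.card_subgroup_dvd_card (P 2 : Subgroup G))
    rw [Nat.card_congr φ.toEquiv, natCard_c2Cubed]
    norm_num
  have odd_part : ∀ {r : ℕ × ℕ}, r ∈ laxSizes G → ∀ p : ℕ, p.Prime → p ∣ Nat.card G → p ≠ 2 →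
      r ∈ ramificationSizes (P p) := by
    intro r h p hp hdvd hp2
    have : Fact p.Prime := ⟨hp⟩
    have := nontrivial_sylow P hp hdvd
    exact mem_ramificationSizes_of_isPGroup_odd hp2 (P p).isPGroup' (laxSizes_sylow P h hp hdvd)
  have even_part : ∀ {r : ℕ × ℕ}, r ∈ laxSizes G → 2 ∣ Nat.card G →
      ¬Nonempty (P 2 ≃* C2Cubed) → r ∈ ramificationSizes (P 2) := by
    intro r h hdvd hc
    have := nontrivial_sylow P Nat.prime_two hdvd
    exact mem_ramificationSizes_of_exponent_two_pow (hexp 2 Nat.prime_two hdvd)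
      (hsemi 2 Nat.prime_two hdvd) hc (laxSizes_sylow P h Nat.prime_two hdvd)
  obtain ⟨q, hq, hqdvd⟩ := Nat.exists_prime_and_dvd
    (Finite.one_lt_card_iff_nontrivial.2 ‹Nontrivial G›).ne'
  refine ⟨⟨?_, ?_⟩, fun r₁ r₂ => ⟨?_, ?_⟩⟩
  · rintro ⟨T₁, T₂, hT⟩ p hp hdvd
    have h : (T₁.length, T₂.length) ∈ laxSizes G :=
      mem_laxSizes_of_mem_ramificationSizes ⟨T₁, T₂, hT, rfl, rfl⟩
    have of_mem : ∀ {r : ℕ × ℕ}, r ∈ ramificationSizes (P p) →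
        HasRamificationStructure (P p) := fun ⟨U₁, U₂, hU, _⟩ => ⟨U₁, U₂, hU⟩
    by_cases hp2 : p = 2
    · subst hp2
      by_cases hc : Nonempty (P 2 ≃* C2Cubed)
      · obtain ⟨φ⟩ := hc
        -- The lax size inherited from `G` need not be a proper size here, so a fixed structure is
        -- used instead.
        exact of_mem (ramificationSizes_of_mulEquiv φ.symm six_six_mem_ramificationSizes_c2Cubed)
      · exact of_mem (even_part h hdvd hc)
    · exact of_mem (odd_part h p hp hdvd hp2)
  · intro h
    have hsize : ∀ p : ℕ, ∃ n : ℕ, n ≠ 0 ∧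
        (p.Prime → p ∣ Nat.card G → (n, n) ∈ ramificationSizes (P p)) := by
      intro p
      by_cases hp : p.Prime ∧ p ∣ Nat.card G
      · obtain ⟨T₁, T₂, hT⟩ := h p hp.1 hp.2
        have := nontrivial_sylow P hp.1 hp.2
        have hlax := (isRamificationStructure_iff.1 hT).1
        have h₁ := (List.length_pos_of_ne_nil hlax.left.ne_nil).ne'
        have h₂ := (List.length_pos_of_ne_nil hlax.right.ne_nil).ne'
        -- Repeating each tuple as often as the other is long makes both lengths equal; the product
        -- of these lengths over all primes then serves every Sylow subgroup.
        have hmul := ramificationSizes_mul h₂ h₁ ⟨T₁, T₂, hT, rfl, rfl⟩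
        rw [mul_comm T₁.length] at hmul
        exact ⟨_, mul_ne_zero h₂ h₁, fun _ _ => hmul⟩
      · exact ⟨1, one_ne_zero, fun h₁ h₂ => absurd ⟨h₁, h₂⟩ hp⟩
    choose n hn0 hn using hsize
    have hall : ∀ p : ℕ, p.Prime → p ∣ Nat.card G →
        (∏ p ∈ (Nat.card G).primeFactors, n p, ∏ p ∈ (Nat.card G).primeFactors, n p) ∈
          ramificationSizes (P p) := by
      intro p hp hdvd
      have := nontrivial_sylow P hp hdvd
      have hmem : p ∈ (Nat.card G).primeFactors :=
        Nat.mem_primeFactors.2 ⟨hp, hdvd, Nat.card_pos.ne'⟩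
      rw [← Finset.prod_erase_mul _ _ hmem]
      have h0 : ∏ p ∈ (Nat.card G).primeFactors.erase p, n p ≠ 0 :=
        Finset.prod_ne_zero_iff.2 fun i _ => hn0 i
      exact ramificationSizes_mul h0 h0 (hn p hp hdvd)
    obtain ⟨T₁, T₂, hT, -⟩ := ramificationSizes_of_sylow P (fun p hp hdvd => by
      have := nontrivial_sylow P hp hdvd
      exact mem_laxSizes_of_mem_ramificationSizes (hall p hp hdvd)) hq hqdvd (hall q hq hqdvd)
    exact ⟨T₁, T₂, hT⟩
  · intro h
    have hlax := mem_laxSizes_of_mem_ramificationSizes h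
    refine ⟨?_, odd_part hlax, even_part hlax, fun hc => ?_⟩
    · obtain ⟨T₁, T₂, hT, rfl, rfl⟩ := hlax
      exact ⟨rank_lt_length hT.left, rank_lt_length hT.right⟩
    · obtain ⟨φ⟩ := id hc
      obtain ⟨h₁, h₂, h₃⟩ := five_le_of_mem_laxSizes_c2Cubed
        (laxSizes_of_mulEquiv φ (laxSizes_sylow P hlax Nat.prime_two (two_dvd hc)))
      exact ⟨h₁, h₂, h₃, fun ⟨ψ⟩ =>
        not_odd_of_mem_ramificationSizes_c2Cubed (ramificationSizes_of_mulEquiv ψ h)⟩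
  · rintro ⟨-, hodd, htwo, hc⟩
    by_cases hG : Nonempty (P 2 ≃* C2Cubed)
    · obtain ⟨h₁, h₂, h₃, h₄⟩ := hc hG
      obtain ⟨φ⟩ := id hG
      by_cases hp : ∃ p : ℕ, p.Prime ∧ p ∣ Nat.card G ∧ p ≠ 2
      · obtain ⟨p, hp, hdvd, hp2⟩ := hp
        -- The odd Sylow subgroup supplies non-trivial entries, so the 2-part may be lax and both
        -- sizes may be odd.
        refine ramificationSizes_of_sylow P (fun p hp hdvd => ?_) hp hdvd (hodd p hp hdvd hp2)
        by_cases hp2 : p = 2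
        · subst hp2
          exact laxSizes_of_mulEquiv φ.symm (mem_laxSizes_c2Cubed h₁ h₂ h₃)
        · have := nontrivial_sylow P hp hdvd
          exact mem_laxSizes_of_mem_ramificationSizes (hodd p hp hdvd hp2)
      -- Without odd primes `G` equals its Sylow 2-subgroup, and the parity condition becomes
      -- available.
      · push Not at hp
        have : Fact (Nat.Prime 2) := ⟨Nat.prime_two⟩
        have hpG : IsPGroup 2 G := IsPGroup.iff_card.2
          ⟨_, Nat.eq_prime_pow_of_unique_prime_dvd Nat.card_pos.ne'
            fun {d} hd hdvd => hp d hd hdvd⟩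
        have htop : ((P 2 : Sylow 2 G) : Subgroup G) = ⊤ :=
          ((P 2).is_maximal' (hpG.to_subgroup ⊤) le_top).symm
        have ψ : G ≃* C2Cubed :=
          (Subgroup.topEquiv.symm.trans (MulEquiv.subgroupCongr htop.symm)).trans φ
        exact ramificationSizes_of_mulEquiv ψ.symm
          (mem_ramificationSizes_c2Cubed h₁ h₂ (h₄ ⟨ψ⟩))
    · have hall : ∀ p : ℕ, p.Prime → p ∣ Nat.card G → (r₁, r₂) ∈ ramificationSizes (P p) := by
        intro p hp hdvd
        by_cases hp2 : p = 2
        · subst hp2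
          exact htwo hdvd hG
        · exact hodd p hp hdvd hp2
      refine ramificationSizes_of_sylow P (fun p hp hdvd => ?_) hq hqdvd (hall q hq hqdvd)
      have := nontrivial_sylow P hp hdvd
      exact mem_laxSizes_of_mem_ramificationSizes (hall p hp hdvd)
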